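/- **The game.** Let $n\ge 2$ and $\alpha\ge 0$. In the Adversary Network Creation Game (Adv-NCG) there are $n$ agents, the elements of $V=\{1,\dots,n\}$. A pure strategy of agent $u$ is a finite multiset $S_u$ of elements of $V\setminus\{u\}$; if $v$ occurs $k$ times in $S_u$, then $u$ buys $k$ parallel undirected edges $uv$. A strategy vector $S=(S_u)_{u\in V}$ determines an undirected multigraph $G=(V,E)$, where $E$ is the multiset of all bought edges. Let $d_H(u,v)\in\mathbb{N}\cup\{\infty\}$ be the number of edges of a shortest path from $u$ to $v$ in the multigraph $H$ ($\infty$ if there is none), and let $\delta_H(u)=\sum_{v\in V}d_H(u,v)$. After one edge is deleted uniformly at random, the expected distance cost of $u$ is $$dist_G(u)=\frac1{|E|}\sum_{e\in E}\delta_{G-e}(u),$$ where the sum counts multiplicities; if $E=\emptyset$, then nothing is deleted and $dist_G(u)=\delta_G(u)=\infty$. The cost of agent $u$ is $cost_u(G,\alpha)=\alpha|S_u|+dist_G(u)\in[0,\infty]$, and the social cost is $cost(G,\alpha)=\sum_{u\in V}cost_u(G,\alpha)$. The network is a (pure) Nash equilibrium if no agent can strictly decrease its own cost by replacing its own strategy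 by another one while all other strategies stay fixed. Let $OPT(n,\alpha)$ be the minimum social cost over all networks on $n$ agents, let $maxNE(n,\alpha)$ be the supremum of the social costs of all Nash equilibria on $n$ agents (to be read as $0$ if there is none), and let $$PoA(n,\alpha)=\frac{maxNE(n,\alpha)}{OPT(n,\alpha)}$$ be the Price of Anarchy. **Theorem.** There is an absolute constant $C$ such that for all integers $n\ge2$ and all reals $\alpha\ge0$, $$PoA(n,\alpha)\le C\left(1+\frac{\alpha}{\sqrt n}\right).$$ In particular, the Price of Anarchy is constant for $\alpha=O(\sqrt n)$: for every $K\ge0$ there is a constant $C_K$ such that $PoA(n,\alpha)\le C_K$ for all $n\ge 2$ and all $0\le\alpha\le K\sqrt n$. -/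

import Mathlib

open scoped NNReal ENNReal

namespace AdvNCG

noncomputable section

variable {V : Type*} [Fintype V] [DecidableEq V]

/-- A pure strategy of agent `u`: a finite multiset of agents other than `u`. An agent `v` that
occurs `k` times stands for `k` parallel edges `uv` that are bought (and owned) by `u`. -/
abbrev Strategy (V : Type*) (u : V) : Type _ := {s : Multiset V // u ∉ s}

/-- A strategy vector, that is, a multigraph on `V` with edge-ownership information. -/
abbrev Profile (V : Type*) : Type _ := ∀ u : V, Strategy V u

/-- The multiset of undirected edges of the network: the union (with multiplicities) of the edges
bought by all agents. -/
def edges (S : Profile V) : Multiset (Sym2 V) :=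
  ∑ u : V, (S u).1.map (fun v => s(u, v))

/-- Number of edges on a shortest path from `u` to `v` in the multigraph on `V` with edge multiset
`E`; it is `∞` if there is no path. Parallel edges do not influence path lengths. -/
def hopDist (E : Multiset (Sym2 V)) (u v : V) : ℝ≥0∞ :=
  (((SimpleGraph.fromEdgeSet {e : Sym2 V | e ∈ E}).edist u v : ℕ∞) : ℝ≥0∞)

/-- `δ_G(u)`: the sum of the distances from `u` to all nodes. -/
def distSum (E : Multiset (Sym2 V)) (u : V) : ℝ≥0∞ :=
  ∑ v : V, hopDist E u v

/-- Expected distance cost of `u` after one edge, chosen uniformly at random among all edges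
(counted with multiplicity), is deleted. If there is no edge at all, nothing can be deleted and
the distance cost is that of the edgeless network. -/
def expDist (E : Multiset (Sym2 V)) (u : V) : ℝ≥0∞ :=
  if E = 0 then distSum E u
  else (E.map (fun e => distSum (E.erase e) u)).sum / (Multiset.card E : ℝ≥0∞)

/-- Expected cost of agent `u`: edge cost plus expected distance cost. -/
def agentCost (α : ℝ≥0) (S : Profile V) (u : V) : ℝ≥0∞ :=
  (α : ℝ≥0∞) * (Multiset.card (S u).1 : ℝ≥0∞) + expDist (edges S) u

/-- Social cost of a network: the sum of the costs of all agents. -/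
def socialCost (α : ℝ≥0) (S : Profile V) : ℝ≥0∞ :=
  ∑ u : V, agentCost α S u

/-- Pure Nash equilibrium: no agent can strictly decrease its cost by changing its strategy. -/
def IsNash (α : ℝ≥0) (S : Profile V) : Prop :=
  ∀ (u : V) (s : Strategy V u), ¬ agentCost α (Function.update S u s) u < agentCost α S u

/-- Minimum social cost of a network on `n` nodes with edge price `α`. -/
def optCost (n : ℕ) (α : ℝ≥0) : ℝ≥0∞ :=
  ⨅ S : Profile (Fin n), socialCost α S

/-- Maximum social cost of a Nash equilibrium network on `n` nodes with edge price `α`. -/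
def maxNashCost (n : ℕ) (α : ℝ≥0) : ℝ≥0∞ :=
  ⨆ (S : Profile (Fin n)) (_ : IsNash α S), socialCost α S

/-- The Price of Anarchy on `n` agents with edge price `α`. -/
def priceOfAnarchy (n : ℕ) (α : ℝ≥0) : ℝ≥0∞ :=
  maxNashCost n α / optCost n α

end

end AdvNCG

/-! Finite cost forces the network to stay connected after any single deletion, hence at least n
edges, so `OPT` is at least αn + n(n-1) (`le_socialCost`).

An equilibrium of diameter at most D costs at most 2αn + n²(6D+2) (`IsNash.socialCost_le`). It
contains a robust subnetwork with at most 2n edges (`exists_sparse_subnetwork`), and each agent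
could keep only its own share of it. No separate bound on the number of edges is needed.

It remains to show D = O(1 + α/√n) (`IsNash.dist_le`). By `IsNash.mul_card_le`, if the edge uv
shortens the way from u to each node of W by γ, and the paths from v are short compared with the
number of edges, then γ|W| ≤ 4α. Applied with γ = 1 to nodes at distance 2, this makes every ball of
radius 2 contain on the order of n/(α+1) nodes. A ball of radius about D/4 at one end of a diametral
path contains about D/20 disjoint such balls, and an edge from the other end brings all its nodes
closer by about D/2. Hence D²n/(α+1) = O(α). -/

namespace AdvNCG

/-! ### Distances under the deletion of one edge -/

section Distances

variable {V : Type*}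

/-- The simple graph underlying a multiset of edges. -/
def net (E : Multiset (Sym2 V)) : SimpleGraph V := SimpleGraph.fromEdgeSet {e | e ∈ E}

theorem hopDist_eq (E : Multiset (Sym2 V)) (u v : V) :
    hopDist E u v = ((net E).edist u v : ℝ≥0∞) := rfl

theorem net_adj {E : Multiset (Sym2 V)} {u v : V} : (net E).Adj u v ↔ s(u, v) ∈ E ∧ u ≠ v := by
  simp [net]

theorem net_mono {E F : Multiset (Sym2 V)} (h : E ≤ F) : net E ≤ net F := by
  intro a b hab
  rw [net_adj] at *
  exact ⟨Multiset.mem_of_le h hab.1, hab.2⟩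

theorem edist_le_one {E : Multiset (Sym2 V)} {u v : V} (h : s(u, v) ∈ E) :
    (net E).edist u v ≤ 1 := by
  rw [SimpleGraph.edist_le_one_iff_adj_or_eq, net_adj]
  tauto

theorem edist_anti {E F : Multiset (Sym2 V)} (h : E ≤ F) (u v : V) :
    (net F).edist u v ≤ (net E).edist u v := SimpleGraph.edist_anti (net_mono h)

theorem hopDist_anti {E F : Multiset (Sym2 V)} (h : E ≤ F) (u v : V) :
    hopDist F u v ≤ hopDist E u v := by
  rw [hopDist_eq, hopDist_eq]
  exact_mod_cast edist_anti h u v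

theorem hopDist_le_iff {E : Multiset (Sym2 V)} {u v : V} {k : ℕ} :
    hopDist E u v ≤ k ↔ (net E).edist u v ≤ k := by
  rw [hopDist_eq]
  exact_mod_cast Iff.rfl

theorem le_hopDist_iff {E : Multiset (Sym2 V)} {u v : V} {k : ℕ} :
    k ≤ hopDist E u v ↔ k ≤ (net E).edist u v := by
  rw [hopDist_eq]
  exact_mod_cast Iff.rfl

theorem edist_eq_dist {G : SimpleGraph V} (hG : G.Connected) (u v : V) :
    G.edist u v = (G.dist u v : ℕ∞) := ((hG u v).coe_dist_eq_edist).symm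

/-- A vertex at prescribed distance from `u` on a shortest path from `u` to `w`. -/
theorem exists_dist_eq {G : SimpleGraph V} (hG : G.Connected) {u w : V} {j : ℕ}
    (hj : j ≤ G.dist u w) : ∃ x, G.dist u x = j ∧ j + G.dist x w = G.dist u w := by
  obtain ⟨p, hp⟩ := hG.exists_walk_length_eq_dist u w
  have h1 := SimpleGraph.dist_le (p.take j)
  have h2 := SimpleGraph.dist_le (p.drop j)
  have h3 := hG.dist_triangle (u := u) (v := p.getVert j) (w := w)
  rw [SimpleGraph.Walk.take_length] at h1
  rw [SimpleGraph.Walk.drop_length] at h2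
  exact ⟨p.getVert j, by omega, by omega⟩

/-- At most `k` edges (with multiplicity) have the property that their deletion destroys all
paths of length at most `k` between two given nodes at distance at most `k`. -/
theorem card_filter_lt_edist_erase [DecidableEq V] (E : Multiset (Sym2 V)) {k : ℕ} {v w : V}
    (h : (net E).edist v w ≤ k) :
    Multiset.card (E.filter fun e => (k : ℕ∞) < (net (E.erase e)).edist v w) ≤ k := by
  have key : ∀ {v w : V} (p : (net E).Walk v w),
      Multiset.card (E.filter fun e => (p.length : ℕ∞) < (net (E.erase e)).edist v w)
        ≤ p.length := by
    intro v w p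
    induction p with
    | nil => simp
    | @cons v x w hvx p ih =>
      -- By the triangle inequality a harmful deletion harms the first edge or the rest of the walk.
      have hsub : (E.filter fun e =>
            (((SimpleGraph.Walk.cons hvx p).length : ℕ) : ℕ∞) < (net (E.erase e)).edist v w) ≤
          (E.filter fun e => (p.length : ℕ∞) < (net (E.erase e)).edist x w) +
          (E.filter fun e => 1 < (net (E.erase e)).edist v x) := by
        rw [Multiset.filter_add_filter]
        refine le_trans (Multiset.monotone_filter_right E ?_) (Multiset.le_add_right _ _)
        intro e he
        by_contra! hc
        have h1 := (net (E.erase e)).edist_triangle (u := v) (v := x) (w := w)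
        have h2 := add_le_add hc.2 hc.1
        rw [SimpleGraph.Walk.length_cons, Nat.cast_add, Nat.cast_one, add_comm] at he
        exact absurd (he.trans_le (h1.trans h2)) (lt_irrefl _)
      have hone : Multiset.card (E.filter fun e => 1 < (net (E.erase e)).edist v x) ≤ 1 := by
        have hmem := (net_adj.1 hvx).1
        -- With a parallel copy no deletion separates v from x; without one, only the edge itself
        -- does.
        by_cases hc : s(v, x) ∈ E.erase s(v, x)
        · rw [Multiset.filter_eq_nil.2]
          · simp
          · intro e _
            rw [not_lt]
            apply edist_le_one
            by_cases hes : e = s(v, x)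
            · rw [hes]; exact hc
            · exact (Multiset.mem_erase_of_ne (Ne.symm hes)).2 hmem
        · have hE : E = s(v, x) ::ₘ E.erase s(v, x) := (Multiset.cons_erase hmem).symm
          have h0 : (E.erase s(v, x)).filter (fun e => 1 < (net (E.erase e)).edist v x) = 0 := by
            rw [Multiset.filter_eq_nil]
            intro e he
            rw [not_lt]
            apply edist_le_one
            refine (Multiset.mem_erase_of_ne ?_).2 hmem
            rintro rfl
            exact hc he
          have h1 : (E.filter fun e => 1 < (net (E.erase e)).edist v x) ≤
              s(v, x) ::ₘ (E.erase s(v, x)).filter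
                (fun e => 1 < (net (E.erase e)).edist v x) := by
            conv_lhs => rw [← Multiset.cons_erase hmem]
            rw [Multiset.filter_cons]
            rw [Multiset.cons_erase hmem]
            split_ifs
            · rw [Multiset.singleton_add]
            · rw [zero_add]
              exact Multiset.le_cons_self _ _
          refine (Multiset.card_le_card h1).trans ?_
          rw [h0]; simp
      have := Multiset.card_le_card hsub
      rw [Multiset.card_add] at this
      rw [SimpleGraph.Walk.length_cons] at this ⊢
      omega
  obtain ⟨p, hp⟩ := SimpleGraph.exists_walk_of_edist_ne_top (ne_top_of_le_ne_top (by simp) h)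
  have hpk : p.length ≤ k := by rw [← hp] at h; exact_mod_cast h
  refine (Multiset.card_le_card (Multiset.monotone_filter_right E ?_)).trans ((key p).trans hpk)
  intro e he
  exact lt_of_le_of_lt (by exact_mod_cast hpk) he

theorem card_edges [Fintype V] (S : Profile V) :
    Multiset.card (edges S) = ∑ u, Multiset.card (S u).1 := by
  simp [edges, Multiset.card_sum]

end Distances

/-! ### Sparse robust subnetworks -/

section Sparse

variable {V : Type*} [Fintype V] [DecidableEq V]

/-- A network that survives the deletion of any edge contains a sparse one that survives it with
distances bounded in terms of the eccentricity of a node. -/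
theorem exists_sparse_subnetwork (E : Multiset (Sym2 V))
    (hE : ∀ e, (net (E.erase e)).Connected) (v₀ : V) (D : ℕ)
    (hD : ∀ z, (net E).dist v₀ z ≤ D) :
    ∃ H ≤ E, Multiset.card H ≤ 2 * Fintype.card V ∧
      ∀ e a b, (net (H.erase e)).edist a b ≤ ((6 * D + 2 : ℕ) : ℕ∞) := by
  classical
  have hconn : (net E).Connected :=
    (hE s(v₀, v₀)).mono (net_mono (Multiset.erase_le _ _))
  -- Parents in a breadth-first tree; the root is its own parent, so that `p` can be iterated.
  have hpar : ∀ z, ∃ q, (z = v₀ → q = v₀) ∧ (z ≠ v₀ → s(z, q) ∈ E ∧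
      (net E).dist v₀ q + 1 = (net E).dist v₀ z) := by
    intro z
    by_cases hz : z = v₀
    · exact ⟨v₀, fun _ => rfl, fun h => absurd hz h⟩
    · have hpos := hconn.pos_dist_of_ne (Ne.symm hz)
      obtain ⟨x, hx1, hx2⟩ := exists_dist_eq hconn
        (show (net E).dist v₀ z - 1 ≤ (net E).dist v₀ z by omega)
      refine ⟨x, fun h => absurd h hz, fun _ => ⟨?_, by omega⟩⟩
      have hadj : (net E).Adj x z := SimpleGraph.dist_eq_one_iff_adj.1 (by omega)
      rw [Sym2.eq_swap]
      exact (net_adj.1 hadj).1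
  choose p hp0 hp using hpar
  set d : V → ℕ := fun z => (net E).dist v₀ z with hd
  -- For w other than the root: z lies in the subtree hanging from w.
  let sub : V → V → Prop := fun w z => ∃ k, p^[k] z = w
  have hsub0 : ∀ w, w ≠ v₀ → ¬ sub w v₀ := by
    rintro w hw ⟨k, hk⟩
    rw [Function.iterate_fixed (hp0 v₀ rfl)] at hk
    exact hw hk.symm
  -- A backup for the tree edge above w: some surviving edge, possibly a parallel copy, enters the
  -- subtree.
  have hcross : ∀ w, ∃ ab : V × V, w ≠ v₀ → s(ab.1, ab.2) ∈ E.erase s(w, p w) ∧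
      ¬ sub w ab.1 ∧ sub w ab.2 := by
    intro w
    by_cases hw : w = v₀
    · exact ⟨(v₀, v₀), fun h => absurd hw h⟩
    obtain ⟨q⟩ := (hE s(w, p w)) v₀ w
    obtain ⟨t, -, ht1, ht2⟩ := q.exists_boundary_dart {z | ¬ sub w z} (hsub0 w hw)
      (fun h => h ⟨0, rfl⟩)
    exact ⟨t.toProd, fun _ => ⟨(net_adj.1 t.adj).1, ht1, not_not.1 ht2⟩⟩
  choose g hg using hcross
  let part : V → Multiset (Sym2 V) := fun w =>
    if w = v₀ then 0 else s(w, p w) ::ₘ {s((g w).1, (g w).2)}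
  have hpartle : ∀ w, part w ≤ E := by
    intro w
    by_cases hw : w = v₀
    · simp [part, hw]
    · simp only [part, hw, if_false]
      rw [← Multiset.cons_erase (hp w hw).1]
      exact Multiset.cons_le_cons _ (Multiset.singleton_le.2 (hg w hw).1)
  have hpartcard : ∀ w, Multiset.card (part w) ≤ 2 := by
    intro w
    by_cases hw : w = v₀ <;> simp [part, hw]
  -- The supremum stays below E, while a sum could exceed multiplicities; parallel backups survive
  -- because each part lies below it as a multiset.
  let H : Multiset (Sym2 V) := Finset.univ.sup part
  have hpartH : ∀ w, part w ≤ H := fun w => Finset.le_sup (f := part) (Finset.mem_univ w)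
  have hpH : ∀ w, w ≠ v₀ → s(w, p w) ∈ H := by
    intro w hw
    apply Multiset.mem_of_le (hpartH w)
    simp [part, hw]
  have hgH : ∀ w, w ≠ v₀ → s((g w).1, (g w).2) ∈ H.erase s(w, p w) := by
    intro w hw
    apply Multiset.mem_of_le (Multiset.erase_le_erase _ (hpartH w))
    simp [part, hw]
  refine ⟨H, Finset.sup_le fun w _ => hpartle w, ?_, ?_⟩
  · have h1 : H ≤ ∑ w, part w :=
      Finset.sup_le fun w hw => Finset.single_le_sum (f := part) (fun _ _ => zero_le) hw
    refine (Multiset.card_le_card h1).trans ?_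
    rw [Multiset.card_sum]
    refine (Finset.sum_le_sum fun w _ => hpartcard w).trans ?_
    simp [mul_comm]
  · intro e
    -- Worst case: down the tree to the backup edge, across it, up to w and down to z. That is three
    -- tree paths and one edge.
    have hroot : ∀ z, (net (H.erase e)).edist v₀ z ≤ ((3 * D + 1 : ℕ) : ℕ∞) := by
      by_cases hw : ∃ w, w ≠ v₀ ∧ s(w, p w) = e
      · obtain ⟨w, hw, rfl⟩ := hw
        have hmem : ∀ z, z ≠ v₀ → z ≠ w → s(z, p z) ∈ H.erase s(w, p w) := by
          intro z hz hzw
          refine (Multiset.mem_erase_of_ne ?_).2 (hpH z hz)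
          intro heq
          rcases Sym2.eq_iff.1 heq with ⟨h1, -⟩ | ⟨h1, h2⟩
          · exact hzw h1
          · have e1 := (hp z hz).2
            have e2 := (hp w hw).2
            rw [h2] at e1
            rw [← h1] at e2
            omega
        have hout : ∀ k z, d z = k → ¬ sub w z →
            (net (H.erase s(w, p w))).edist v₀ z ≤ (k : ℕ∞) := by
          intro k
          induction k with
          | zero =>
            intro z hz _
            rw [(hconn.dist_eq_zero_iff.1 hz)]; simp
          | succ k ih =>
            intro z hz hzs
            have hz0 : z ≠ v₀ := by
              rintro rfl
              simp [hd] at hz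
            have hzw : z ≠ w := by
              rintro rfl
              exact hzs ⟨0, rfl⟩
            have h1 := ih (p z) (by have := (hp z hz0).2; simp only [hd] at hz ⊢; omega)
              (fun ⟨k, hk⟩ => hzs ⟨k + 1, hk⟩)
            have h2 := edist_le_one (hmem z hz0 hzw)
            rw [SimpleGraph.edist_comm] at h2
            exact_mod_cast ((net (H.erase s(w, p w))).edist_triangle).trans (add_le_add h1 h2)
        have hin : ∀ k z, d z = k → sub w z →
            (net (H.erase s(w, p w))).edist z w ≤ (k : ℕ∞) := by
          intro k
          induction k with
          | zero =>
            intro z hz hzs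
            rw [← (hconn.dist_eq_zero_iff.1 hz)] at hzs
            exact absurd hzs (hsub0 w hw)
          | succ k ih =>
            intro z hz hzs
            by_cases hzw : z = w
            · simp [hzw]
            have hz0 : z ≠ v₀ := by
              rintro rfl
              simp [hd] at hz
            obtain ⟨j, hj⟩ := hzs
            have hzs' : sub w (p z) := by
              cases j with
              | zero => exact absurd hj hzw
              | succ j => exact ⟨j, hj⟩
            have h1 := ih (p z) (by have := (hp z hz0).2; simp only [hd] at hz ⊢; omega) hzs'
            have h2 := edist_le_one (hmem z hz0 hzw)
            rw [Nat.cast_add, Nat.cast_one, add_comm]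
            exact ((net (H.erase s(w, p w))).edist_triangle).trans (add_le_add h2 h1)
        intro z
        by_cases hz : sub w z
        · obtain ⟨-, ha, hb⟩ := hg w hw
          have h1 := hout _ _ rfl ha
          have h2 := edist_le_one (hgH w hw)
          have h3 := hin _ _ rfl hb
          have h4 := hin _ _ rfl hz
          rw [SimpleGraph.edist_comm] at h4
          have h5 := ((net (H.erase s(w, p w))).edist_triangle).trans (add_le_add h1 h2)
          have h6 := ((net (H.erase s(w, p w))).edist_triangle).trans (add_le_add h5 h3)
          have h7 := ((net (H.erase s(w, p w))).edist_triangle).trans (add_le_add h6 h4)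
          refine h7.trans ?_
          have := hD (g w).1
          have := hD (g w).2
          have := hD z
          simp only [hd]
          norm_cast
          omega
        · refine (hout _ z rfl hz).trans ?_
          have := hD z
          simp only [hd]
          norm_cast
          omega
      · push Not at hw
        have hall : ∀ k z, d z = k → (net (H.erase e)).edist v₀ z ≤ (k : ℕ∞) := by
          intro k
          induction k with
          | zero =>
            intro z hz
            rw [(hconn.dist_eq_zero_iff.1 hz)]; simp
          | succ k ih =>
            intro z hz
            have hz0 : z ≠ v₀ := by
              rintro rfl
              simp [hd] at hz
            have h1 := ih (p z) (by have := (hp z hz0).2; simp only [hd] at hz ⊢; omega)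
            have h2 : (net (H.erase e)).edist z (p z) ≤ 1 :=
              edist_le_one ((Multiset.mem_erase_of_ne (hw z hz0)).2 (hpH z hz0))
            rw [SimpleGraph.edist_comm] at h2
            exact_mod_cast ((net (H.erase e)).edist_triangle).trans (add_le_add h1 h2)
        intro z
        refine (hall _ z rfl).trans ?_
        have := hD z
        simp only [hd]
        norm_cast
        omega
    intro a b
    have h1 := hroot a
    rw [SimpleGraph.edist_comm] at h1
    refine (((net (H.erase e)).edist_triangle).trans (add_le_add h1 (hroot b))).trans ?_
    norm_cast
    omega

/-- Every part of a network is the network of a profile of smaller strategies. -/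
theorem exists_profile_of_le_edges (S : Profile V) {H : Multiset (Sym2 V)} (h : H ≤ edges S) :
    ∃ T : Profile V, (∀ u, (T u).1 ≤ (S u).1) ∧ edges T = H := by
  have hmap : ∀ (u : V) (s : Multiset V) (K : Multiset (Sym2 V)),
      K ≤ s.map (fun v => s(u, v)) → ∃ t ≤ s, t.map (fun v => s(u, v)) = K := by
    intro u s
    induction s using Multiset.induction_on with
    | empty => intro K hK; exact ⟨0, le_rfl, (Multiset.le_zero.1 hK).symm⟩
    | cons a s ih =>
      intro K hK
      rw [Multiset.map_cons] at hK
      by_cases ha : s(u, a) ∈ K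
      · obtain ⟨t, ht, htK⟩ := ih (K.erase s(u, a)) (Multiset.erase_le_iff_le_cons.2 hK)
        exact ⟨a ::ₘ t, Multiset.cons_le_cons a ht, by
          rw [Multiset.map_cons, htK, Multiset.cons_erase ha]⟩
      · obtain ⟨t, ht, htK⟩ := ih K ((Multiset.le_cons_of_notMem ha).1 hK)
        exact ⟨t, ht.trans (Multiset.le_cons_self s a), htK⟩
  have hsum : ∀ (A : Finset V) (K : Multiset (Sym2 V)),
      K ≤ ∑ u ∈ A, (S u).1.map (fun v => s(u, v)) →
      ∃ T : Profile V, (∀ u, (T u).1 ≤ (S u).1) ∧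
        ∑ u ∈ A, (T u).1.map (fun v => s(u, v)) = K := by
    intro A
    induction A using Finset.induction_on with
    | empty => intro K hK; exact ⟨S, fun _ => le_rfl, (Multiset.le_zero.1 hK).symm⟩
    | insert a A ha ih =>
      intro K hK
      rw [Finset.sum_insert ha] at hK
      -- Agent a takes all it can of K, namely the intersection; the others cover the difference.
      obtain ⟨T, hTS, hT⟩ := ih (K - (S a).1.map (fun v => s(a, v))) (tsub_le_iff_left.2 hK)
      obtain ⟨t, ht, htK⟩ := hmap a (S a).1 (K ∩ (S a).1.map (fun v => s(a, v)))
        Multiset.inter_le_right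
      refine ⟨Function.update T a ⟨t, fun hat => (S a).2 (Multiset.mem_of_le ht hat)⟩,
        fun u => ?_, ?_⟩
      · by_cases hu : u = a
        · subst hu
          simpa using ht
        · rw [Function.update_of_ne hu]
          exact hTS u
      rw [Finset.sum_insert ha, Function.update_self, htK]
      rw [Finset.sum_congr rfl fun u hu => by
        rw [Function.update_of_ne (ne_of_mem_of_not_mem hu ha)], hT]
      rw [add_comm]
      exact Multiset.sub_add_inter _ _
  exact hsum Finset.univ H h

end Sparse

/-! ### Cost bounds and equilibrium conditions -/

section Costs

variable {V : Type*} [Fintype V]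

theorem distSum_anti {E F : Multiset (Sym2 V)} (h : E ≤ F) (u : V) :
    distSum F u ≤ distSum E u :=
  Finset.sum_le_sum fun v _ => hopDist_anti h u v

theorem card_sub_one_le_distSum (E : Multiset (Sym2 V)) (u : V) :
    ((Fintype.card V - 1 : ℕ) : ℝ≥0∞) ≤ distSum E u := by
  classical
  have h1 : ∑ v ∈ Finset.univ.erase u, (1 : ℝ≥0∞) ≤ ∑ v ∈ Finset.univ.erase u, hopDist E u v := by
    refine Finset.sum_le_sum fun v hv => ?_
    have hne : u ≠ v := (Finset.ne_of_mem_erase hv).symm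
    have := le_hopDist_iff (E := E) (u := u) (v := v) (k := 1)
    rw [Nat.cast_one, Nat.cast_one] at this
    exact this.2 (Order.one_le_iff_pos.2 (SimpleGraph.edist_pos_of_ne hne))
  have h2 : ∑ v ∈ Finset.univ.erase u, hopDist E u v ≤ distSum E u :=
    Finset.sum_le_sum_of_subset (Finset.erase_subset _ _)
  refine le_trans ?_ (h1.trans h2)
  simp [Finset.card_erase_of_mem]

variable [DecidableEq V]

theorem card_mul_distSum_le (E : Multiset (Sym2 V)) (u : V) :
    (Multiset.card E : ℝ≥0∞) * distSum E u ≤ (E.map fun e => distSum (E.erase e) u).sum := by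
  rw [← nsmul_eq_mul, ← Multiset.sum_replicate, ← Multiset.map_const']
  exact Multiset.sum_map_le_sum_map _ _ fun e _ => distSum_anti (Multiset.erase_le _ _) u

theorem card_mul_expDist {E : Multiset (Sym2 V)} (hE : E ≠ 0) (u : V) :
    (Multiset.card E : ℝ≥0∞) * expDist E u = (E.map fun e => distSum (E.erase e) u).sum := by
  rw [expDist, if_neg hE]
  exact ENNReal.mul_div_cancel (by simpa using hE) (by simp)

theorem distSum_le_expDist (E : Multiset (Sym2 V)) (u : V) : distSum E u ≤ expDist E u := by
  by_cases hE : E = 0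
  · rw [expDist, if_pos hE]
  · have h := card_mul_distSum_le E u
    rw [← card_mul_expDist hE] at h
    exact (ENNReal.mul_le_mul_iff_right (by simpa using hE) (by simp)).1 h

theorem expDist_le {E : Multiset (Sym2 V)} {u : V} {k : ℝ≥0∞}
    (h : ∀ e v, hopDist (E.erase e) u v ≤ k) : expDist E u ≤ Fintype.card V * k := by
  have hs : ∀ e, distSum (E.erase e) u ≤ Fintype.card V * k := by
    intro e
    refine (Finset.sum_le_sum fun v _ => h e v).trans ?_
    simp
  by_cases hE : E = 0
  · rw [expDist, if_pos hE]
    simpa [hE] using hs s(u, u)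
  · rw [← ENNReal.mul_le_mul_iff_right (a := (Multiset.card E : ℝ≥0∞)) (by simpa using hE)
      (by simp), card_mul_expDist hE, ← nsmul_eq_mul, ← Multiset.sum_replicate,
      ← Multiset.map_const']
    exact Multiset.sum_map_le_sum_map _ _ fun e _ => hs e

/-- A finite average has only finite terms. Erasing a pair outside E changes nothing. -/
theorem connected_erase_of_expDist {E : Multiset (Sym2 V)} {u : V} (h : expDist E u ≠ ⊤)
    (e : Sym2 V) : (net (E.erase e)).Connected := by
  have hs : distSum (E.erase e) u ≠ ⊤ := by
    by_cases he : e ∈ E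
    · have hE : E ≠ 0 := by
        rintro rfl
        simp at he
      have h2 : (E.map fun e => distSum (E.erase e) u).sum ≠ ⊤ := by
        rw [← card_mul_expDist hE]
        exact ENNReal.mul_ne_top (by simp) h
      exact ne_top_of_le_ne_top h2
        (Multiset.single_le_sum (fun _ _ => zero_le) _ (Multiset.mem_map_of_mem _ he))
    · rw [Multiset.erase_of_notMem he]
      exact ne_top_of_le_ne_top h (distSum_le_expDist E u)
  have hr : ∀ v, (net (E.erase e)).Reachable u v := by
    intro v
    rw [← SimpleGraph.edist_ne_top_iff_reachable]
    have := ENNReal.sum_ne_top.1 hs v (Finset.mem_univ v)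
    rw [hopDist_eq] at this
    simpa using this
  have : Nonempty V := ⟨u⟩
  exact ⟨fun v w => (hr v).symm.trans (hr w)⟩

/-- What is left after a deletion still has a spanning tree; the deleted edge is one more. -/
theorem card_le_card_of_connected_erase {E : Multiset (Sym2 V)} (hV : 2 ≤ Fintype.card V)
    (hE : ∀ e, (net (E.erase e)).Connected) : Fintype.card V ≤ Multiset.card E := by
  have h0 : E ≠ 0 := by
    rintro rfl
    obtain ⟨a, b, hab⟩ := Fintype.exists_pair_of_one_lt_card hV
    obtain ⟨c, hc⟩ := (hE s(a, b)).preconnected.exists_isPath a b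
    cases c with
    | nil => exact hab rfl
    | cons h _ =>
      have := (net_adj.1 h).1
      simp at this
  obtain ⟨e, he⟩ := Multiset.exists_mem_of_ne_zero h0
  have h1 := (hE e).card_vert_le_card_edgeSet_add_one
  have h2 : (net (E.erase e)).edgeSet ⊆ ((E.erase e).toFinset : Set (Sym2 V)) := by
    intro x hx
    rw [net, SimpleGraph.edgeSet_fromEdgeSet] at hx
    simpa using hx.1
  have h3 := Set.ncard_le_ncard h2 (Finset.finite_toSet _)
  rw [Set.ncard_coe_finset] at h3
  have h4 := Multiset.toFinset_card_le (E.erase e)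
  have h5 := Multiset.card_erase_add_one he
  rw [Nat.card_eq_fintype_card, Nat.card_coe_set_eq] at h1
  omega

theorem socialCost_eq (α : ℝ≥0) (S : Profile V) :
    socialCost α S = α * Multiset.card (edges S) + ∑ u, expDist (edges S) u := by
  rw [socialCost, card_edges, Nat.cast_sum, Finset.mul_sum, ← Finset.sum_add_distrib]
  rfl

theorem le_socialCost (hV : 2 ≤ Fintype.card V) (α : ℝ≥0) (S : Profile V) :
    (α : ℝ≥0∞) * Fintype.card V + Fintype.card V * (Fintype.card V - 1 : ℕ) ≤ socialCost α S := by
  rw [socialCost_eq]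
  by_cases h : ∃ u, expDist (edges S) u ≠ ⊤
  · obtain ⟨u, hu⟩ := h
    have hm := card_le_card_of_connected_erase hV (connected_erase_of_expDist hu)
    refine add_le_add (by gcongr) ?_
    refine le_trans ?_ (Finset.sum_le_sum fun v _ =>
      (card_sub_one_le_distSum (edges S) v).trans (distSum_le_expDist (edges S) v))
    simp
  · push Not at h
    have hne : Nonempty V := Fintype.card_pos_iff.1 (by omega)
    obtain ⟨u⟩ := hne
    have : ∑ u, expDist (edges S) u = ⊤ := ENNReal.sum_eq_top.2 ⟨u, Finset.mem_univ u, h u⟩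
    rw [this]
    simp

theorem edges_update (S : Profile V) (u : V) (s : Strategy V u) :
    edges (Function.update S u s) = s.1.map (fun v => s(u, v)) +
      ∑ w ∈ Finset.univ.erase u, (S w).1.map (fun v => s(w, v)) := by
  rw [edges, ← Finset.add_sum_erase _ _ (Finset.mem_univ u), Function.update_self]
  congr 1
  refine Finset.sum_congr rfl fun w hw => ?_
  rw [Function.update_of_ne (Finset.ne_of_mem_erase hw)]

/-- Buying two parallel edges to every other node has finite cost, since one copy survives any
deletion. -/
theorem IsNash.expDist_ne_top {α : ℝ≥0} {S : Profile V} (hS : IsNash α S) (u : V) :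
    expDist (edges S) u ≠ ⊤ := by
  let A : Multiset V := Finset.univ.val.filter (· ≠ u)
  have hA : u ∉ A + A := by simp [A]
  have h := not_lt.1 (hS u ⟨A + A, hA⟩)
  have hfin : agentCost α (Function.update S u ⟨A + A, hA⟩) u ≠ ⊤ := by
    rw [agentCost, Function.update_self]
    refine ENNReal.add_ne_top.2 ⟨ENNReal.mul_ne_top (by simp) (by simp), ?_⟩
    refine ne_top_of_le_ne_top ?_ (expDist_le (k := ((1 : ℕ) : ℝ≥0∞)) ?_)
    · exact ENNReal.mul_ne_top (by simp) (by simp)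
    intro e v
    rw [hopDist_le_iff]
    by_cases hv : v = u
    · simp [hv]
    rw [Nat.cast_one]
    apply edist_le_one
    rw [edges_update]
    have hmem : s(u, v) ∈ A.map (fun v => s(u, v)) :=
      Multiset.mem_map_of_mem _ (by simpa [A] using hv)
    refine Multiset.mem_of_le (Multiset.erase_le_erase e (Multiset.le_add_right _ _)) ?_
    rw [Multiset.map_add]
    by_cases he : e ∈ A.map (fun v => s(u, v))
    · rw [Multiset.erase_add_left_pos _ he]
      exact Multiset.mem_add.2 (Or.inr hmem)
    · have hne : s(u, v) ≠ e := by
        rintro rfl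
        exact he hmem
      rw [Multiset.mem_erase_of_ne hne]
      exact Multiset.mem_add.2 (Or.inr hmem)
  exact ne_top_of_le_ne_top (ne_top_of_le_ne_top hfin h) le_add_self

/-- What buying one more edge saves, summed over all deletions, does not exceed its price. -/
theorem IsNash.sum_distSum_erase_le {α : ℝ≥0} {S : Profile V} (hS : IsNash α S)
    (hE : edges S ≠ 0) {u v : V} (huv : u ≠ v) :
    ((edges S).map fun e => distSum ((edges S).erase e) u).sum ≤
      α * (Multiset.card (edges S) + 1) +
      ((edges S).map fun e => distSum (s(u, v) ::ₘ (edges S).erase e) u).sum := by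
  have hs : u ∉ v ::ₘ (S u).1 := by
    rw [Multiset.mem_cons, not_or]
    exact ⟨huv, (S u).2⟩
  have h := not_lt.1 (hS u ⟨v ::ₘ (S u).1, hs⟩)
  have hedges : edges (Function.update S u ⟨v ::ₘ (S u).1, hs⟩) = s(u, v) ::ₘ edges S := by
    rw [edges_update, Multiset.map_cons, Multiset.cons_add,
      ← edges_update S u (S u), Function.update_eq_self]
  rw [agentCost, agentCost, hedges, Function.update_self, Multiset.card_cons, Nat.cast_add,
    Nat.cast_one, mul_add, mul_one, add_assoc] at h
  replace h := (ENNReal.add_le_add_iff_left (ENNReal.mul_ne_top (by simp) (by simp))).1 h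
  have hfin := hS.expDist_ne_top u
  set E := edges S
  -- One of the deletions removes the new edge and restores E; its term is at most `expDist E u`,
  -- which cancels below.
  have hnew : ((Multiset.card E : ℝ≥0∞) + 1) * expDist (s(u, v) ::ₘ E) u =
      distSum E u + (E.map fun e => distSum (s(u, v) ::ₘ E.erase e) u).sum := by
    have := card_mul_expDist (Multiset.cons_ne_zero (a := s(u, v)) (m := E)) u
    rw [Multiset.card_cons, Nat.cast_add, Nat.cast_one] at this
    rw [this, Multiset.map_cons, Multiset.sum_cons, Multiset.erase_cons_head]
    congr 2
    refine Multiset.map_congr rfl fun e he => ?_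
    rw [Multiset.erase_cons_tail_of_mem he]
  have h2 : ((Multiset.card E : ℝ≥0∞) + 1) * expDist E u ≤
      α * (Multiset.card E + 1) +
      (E.map fun e => distSum (s(u, v) ::ₘ E.erase e) u).sum + expDist E u := by
    calc ((Multiset.card E : ℝ≥0∞) + 1) * expDist E u
        ≤ (Multiset.card E + 1) * (α + expDist (s(u, v) ::ₘ E) u) := by gcongr
      _ = α * (Multiset.card E + 1) + (distSum E u +
          (E.map fun e => distSum (s(u, v) ::ₘ E.erase e) u).sum) := by
        rw [mul_add, hnew, mul_comm]
      _ ≤ α * (Multiset.card E + 1) + (expDist E u +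
          (E.map fun e => distSum (s(u, v) ::ₘ E.erase e) u).sum) := by
        gcongr
        exact distSum_le_expDist E u
      _ = _ := by ring
  rw [add_mul, one_mul, card_mul_expDist hE] at h2
  exact (ENNReal.add_le_add_iff_right hfin).1 h2

theorem sum_map_add_card_filter_mul_le {ι : Type*} (s : Multiset ι) (p : ι → Prop)
    [DecidablePred p] {f g : ι → ℝ≥0∞} {c : ℝ≥0∞} (h : ∀ i ∈ s, f i ≤ g i)
    (hp : ∀ i ∈ s, p i → f i + c ≤ g i) :
    (s.map f).sum + Multiset.card (s.filter p) * c ≤ (s.map g).sum := by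
  induction s using Multiset.induction_on with
  | empty => simp
  | cons a s ih =>
    have ih := ih (fun i hi => h i (Multiset.mem_cons_of_mem hi))
      (fun i hi => hp i (Multiset.mem_cons_of_mem hi))
    rw [Multiset.map_cons, Multiset.sum_cons, Multiset.map_cons, Multiset.sum_cons]
    by_cases ha : p a
    · rw [Multiset.filter_cons_of_pos _ ha, Multiset.card_cons, Nat.cast_add, Nat.cast_one]
      calc _ = (f a + c) + ((s.map f).sum + Multiset.card (s.filter p) * c) := by ring
        _ ≤ _ := add_le_add (hp a (Multiset.mem_cons_self a s) ha) ih
    · rw [Multiset.filter_cons_of_neg _ ha, add_assoc]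
      exact add_le_add (h a (Multiset.mem_cons_self a s)) ih

/-- If buying the edge `uv` brings all nodes of `W` closer to `u` by at least `γ`, in the sense
that they are much closer to `v` than to `u`, then `W` is small in an equilibrium. -/
theorem IsNash.mul_card_le {α : ℝ≥0} {S : Profile V} (hS : IsNash α S)
    (hE : edges S ≠ 0) {u v : V} (huv : u ≠ v) (W : Finset V) (γ : ℕ)
    (hW : ∀ w ∈ W, ∃ r, (net (edges S)).dist v w ≤ r ∧ r + 1 + γ ≤ (net (edges S)).dist u w ∧
      2 * r ≤ Multiset.card (edges S)) :
    (γ * W.card : ℝ) ≤ 4 * α := by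
  have hkey := hS.sum_distSum_erase_le hE huv
  have hfin := hS.expDist_ne_top u
  have hcon := connected_erase_of_expDist hfin
  set E := edges S
  have hconE : (net E).Connected := (hcon s(u, u)).mono (net_mono (Multiset.erase_le _ _))
  have hAfin : (E.map fun e => distSum (E.erase e) u).sum ≠ ⊤ := by
    rw [← card_mul_expDist hE]
    exact ENNReal.mul_ne_top (by simp) hfin
  have hanti : ∀ e w, hopDist (s(u, v) ::ₘ E.erase e) u w ≤ hopDist (E.erase e) u w :=
    fun e w => hopDist_anti (Multiset.le_cons_self _ _) u w
  have hw : ∀ w, 2 * (E.map fun e => hopDist (s(u, v) ::ₘ E.erase e) u w).sum +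
      (if w ∈ W then (Multiset.card E * γ : ℝ≥0∞) else 0) ≤
      2 * (E.map fun e => hopDist (E.erase e) u w).sum := by
    intro w
    split_ifs with hwW
    · obtain ⟨r, hr, hγ, hrm⟩ := hW w hwW
      -- At most r deletions are bad for w, hence at least half are good. In a good one the new edge
      -- gives distance at most r + 1, against at least r + 1 + γ without it.
      have hbad := card_filter_lt_edist_erase E (k := r) (v := v) (w := w)
        (by rw [edist_eq_dist hconE]; exact_mod_cast hr)
      have hsplit := congrArg Multiset.card (Multiset.filter_add_not
        (fun e => (r : ℕ∞) < (net (E.erase e)).edist v w) E)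
      rw [Multiset.card_add] at hsplit
      have hmain := sum_map_add_card_filter_mul_le E
        (fun e => ¬ (r : ℕ∞) < (net (E.erase e)).edist v w)
        (f := fun e => hopDist (s(u, v) ::ₘ E.erase e) u w)
        (g := fun e => hopDist (E.erase e) u w) (c := γ) (fun e _ => hanti e w) (by
          intro e _ he
          have h1 : hopDist (s(u, v) ::ₘ E.erase e) u w ≤ ((r + 1 : ℕ) : ℝ≥0∞) := by
            rw [hopDist_le_iff]
            have h1 := edist_le_one (Multiset.mem_cons_self s(u, v) (E.erase e))
            have h2 := (edist_anti (Multiset.le_cons_self (E.erase e) s(u, v)) v w).trans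
              (not_lt.1 he)
            have h3 := SimpleGraph.edist_triangle.trans (add_le_add h1 h2)
            rw [add_comm] at h3
            exact_mod_cast h3
          have h2 : ((r + 1 + γ : ℕ) : ℝ≥0∞) ≤ hopDist (E.erase e) u w := by
            refine le_trans ?_ (hopDist_anti (Multiset.erase_le e E) u w)
            rw [le_hopDist_iff, edist_eq_dist hconE]
            exact_mod_cast hγ
          refine (add_le_add h1 le_rfl).trans (le_trans (le_of_eq ?_) h2)
          push_cast
          rfl)
      refine le_trans ?_ (mul_le_mul_right hmain 2)
      rw [mul_add, ← mul_assoc]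
      refine add_le_add le_rfl ?_
      gcongr
      have : Multiset.card E ≤ 2 * Multiset.card
          (E.filter fun e => ¬ (r : ℕ∞) < (net (E.erase e)).edist v w) := by omega
      exact_mod_cast this
    · rw [add_zero]
      gcongr
      exact Multiset.sum_map_le_sum_map _ _ fun e _ => hanti e w
  have hsum := Finset.sum_le_sum fun w (_ : w ∈ Finset.univ) => hw w
  rw [Finset.sum_add_distrib, ← Finset.mul_sum, ← Finset.mul_sum, ← Multiset.sum_map_sum,
    ← Multiset.sum_map_sum, Finset.sum_ite_mem, Finset.univ_inter, Finset.sum_const,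
    nsmul_eq_mul] at hsum
  change 2 * (E.map fun e => distSum (s(u, v) ::ₘ E.erase e) u).sum + _ ≤
    2 * (E.map fun e => distSum (E.erase e) u).sum at hsum
  have hA'fin : (E.map fun e => distSum (s(u, v) ::ₘ E.erase e) u).sum ≠ ⊤ :=
    ne_top_of_le_ne_top hAfin (Multiset.sum_map_le_sum_map _ _ fun e _ =>
      distSum_anti (Multiset.le_cons_self _ _) u)
  have h3 : ((W.card : ℝ≥0∞) * (Multiset.card E * γ)) ≤ 2 * (α * (Multiset.card E + 1)) := by
    refine (ENNReal.add_le_add_iff_left (ENNReal.mul_ne_top (by simp) hA'fin) (a := 2 *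
      (E.map fun e => distSum (s(u, v) ::ₘ E.erase e) u).sum)).1 (hsum.trans ?_)
    calc _ ≤ 2 * (α * (Multiset.card E + 1) +
          (E.map fun e => distSum (s(u, v) ::ₘ E.erase e) u).sum) := by gcongr
      _ = _ := by ring
  have h4 : (W.card : ℝ) * (Multiset.card E * γ) ≤ 2 * (α * (Multiset.card E + 1)) := by
    exact_mod_cast h3
  have hm : (1 : ℝ) ≤ Multiset.card E := by
    exact_mod_cast Multiset.card_pos.2 hE
  have hα : (0 : ℝ) ≤ α := α.2
  have h5 : (γ * W.card : ℝ) * Multiset.card E ≤ 4 * α * Multiset.card E := by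
    nlinarith [mul_le_mul_of_nonneg_left hm hα]
  exact le_of_mul_le_mul_right h5 (by linarith)

end Costs

/-! ### Ball growth and the diameter of equilibria -/

section Diameter

variable {V : Type*} [Fintype V]

/-- The set of nodes at distance at most `r` from `u`. -/
noncomputable def hopBall (G : SimpleGraph V) (u : V) (r : ℕ) : Finset V := {w | G.dist u w ≤ r}

theorem mem_hopBall {G : SimpleGraph V} {u w : V} {r : ℕ} :
    w ∈ hopBall G u r ↔ G.dist u w ≤ r := by
  simp [hopBall]

theorem add_one_le_card_hopBall {G : SimpleGraph V} (hG : G.Connected) {u w : V} {k : ℕ}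
    (hk : k ≤ G.dist u w) : k + 1 ≤ (hopBall G u k).card := by
  have hx : ∀ j, ∃ x, j ≤ k → G.dist u x = j := by
    intro j
    by_cases hj : j ≤ k
    · obtain ⟨x, hx, -⟩ := exists_dist_eq hG (hj.trans hk)
      exact ⟨x, fun _ => hx⟩
    · exact ⟨u, fun h => absurd h hj⟩
  choose x hx using hx
  rw [← Finset.card_range (k + 1)]
  refine Finset.card_le_card_of_injOn x ?_ ?_
  · intro j hj
    have hj : j < k + 1 := by simpa using hj
    simp only [Finset.mem_coe, mem_hopBall]
    rw [hx j (by omega)]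
    omega
  · intro i hi j hj hij
    have hi : i < k + 1 := by simpa using hi
    have hj : j < k + 1 := by simpa using hj
    rw [← hx i (by omega), ← hx j (by omega), hij]

theorem dist_lt_card {G : SimpleGraph V} (hG : G.Connected) (u w : V) :
    G.dist u w < Fintype.card V :=
  (add_one_le_card_hopBall hG le_rfl).trans (Finset.card_le_univ _)

variable [DecidableEq V]

/-- In an equilibrium all balls of radius two are large. -/
theorem IsNash.card_le_mul_card_hopBall {α : ℝ≥0} {S : Profile V} (hS : IsNash α S)
    (hV : 2 ≤ Fintype.card V) (u : V) :
    (Fintype.card V : ℝ) ≤ 2 * (4 * α + 1) * (hopBall (net (edges S)) u 2).card := by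
  have hcon := connected_erase_of_expDist (hS.expDist_ne_top u)
  have hm := card_le_card_of_connected_erase hV hcon
  have hG : (net (edges S)).Connected :=
    (hcon s(u, u)).mono (net_mono (Multiset.erase_le _ _))
  have hE : edges S ≠ 0 := by
    rw [← Multiset.card_pos]
    omega
  set G := net (edges S) with hGdef
  -- This radius ensures 2r ≤ n ≤ |E|, as `mul_card_le` requires, and the ball still contains half
  -- of the nodes.
  set W := hopBall G u (Fintype.card V / 2) with hWdef
  have hW : Fintype.card V ≤ 2 * W.card := by
    by_cases hall : ∀ w, G.dist u w ≤ Fintype.card V / 2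
    · have : W = Finset.univ := Finset.eq_univ_of_forall fun w => mem_hopBall.2 (hall w)
      rw [this, Finset.card_univ]
      omega
    · push Not at hall
      obtain ⟨w, hw⟩ := hall
      have := add_one_le_card_hopBall hG hw.le
      rw [hWdef]
      omega
  -- Nodes with a shortest path from u through x at distance 2: the edge ux saves each of them one
  -- step.
  let F : V → Finset V := fun x => W.filter fun w => G.dist u x = 2 ∧ 2 + G.dist x w = G.dist u w
  have hcover : W ⊆ (hopBall G u 2).biUnion fun x => insert x (F x) := by
    intro w hw
    rw [Finset.mem_biUnion]
    by_cases h2 : 2 ≤ G.dist u w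
    · obtain ⟨x, hx1, hx2⟩ := exists_dist_eq hG h2
      exact ⟨x, mem_hopBall.2 hx1.le, Finset.mem_insert_of_mem
        (Finset.mem_filter.2 ⟨hw, hx1, hx2⟩)⟩
    · exact ⟨w, mem_hopBall.2 (by omega), Finset.mem_insert_self _ _⟩
  have hα : (0 : ℝ) ≤ α := α.2
  have hF : ∀ x, ((F x).card : ℝ) ≤ 4 * α := by
    intro x
    by_cases hx : G.dist u x = 2
    · have hux : u ≠ x := by
        rintro rfl
        simp at hx
      have := hS.mul_card_le hE hux (F x) 1 (by
        intro w hw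
        obtain ⟨h1, -, h2⟩ := Finset.mem_filter.1 hw
        rw [hWdef, mem_hopBall] at h1
        exact ⟨G.dist x w, le_rfl, by rw [← hGdef]; omega, by omega⟩)
      simpa using this
    · have : F x = ∅ := Finset.filter_eq_empty_iff.2 fun w _ h => hx h.1
      rw [this]
      simp
  have h1 : (W.card : ℝ) ≤ (hopBall G u 2).card * (4 * α + 1) := by
    have h2 := (Finset.card_le_card hcover).trans Finset.card_biUnion_le
    calc (W.card : ℝ) ≤ ∑ x ∈ hopBall G u 2, ((insert x (F x)).card : ℝ) := by exact_mod_cast h2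
      _ ≤ ∑ x ∈ hopBall G u 2, (4 * (α : ℝ) + 1) := by
        refine Finset.sum_le_sum fun x _ => ?_
        have h3 : ((insert x (F x)).card : ℝ) ≤ (F x).card + 1 := by
          exact_mod_cast Finset.card_insert_le _ _
        linarith [hF x]
      _ = _ := by rw [Finset.sum_const, nsmul_eq_mul]
  have h2 : (Fintype.card V : ℝ) ≤ 2 * W.card := by exact_mod_cast hW
  linarith

/-- A ball around the end of a long shortest path contains many disjoint balls of radius two. -/
theorem mul_le_card_hopBall {G : SimpleGraph V} (hG : G.Connected) {u v : V} {r t : ℕ}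
    {b : ℝ} (hb : ∀ x, b ≤ (hopBall G x 2).card) (hr : r ≤ G.dist v u) (ht : 5 * t ≤ r + 3) :
    t * b ≤ (hopBall G v r).card := by
  -- Distances from v that differ by 5 keep radius-2 balls disjoint, and 5(t-1) + 2 ≤ r keeps them
  -- inside.
  have hx : ∀ i, ∃ x, i < t → G.dist v x = 5 * i := by
    intro i
    by_cases hi : i < t
    · obtain ⟨x, hx, -⟩ := exists_dist_eq hG (show 5 * i ≤ G.dist v u by omega)
      exact ⟨x, fun _ => hx⟩
    · exact ⟨u, fun h => absurd h hi⟩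
  choose x hx using hx
  have hdisj : Set.PairwiseDisjoint (Finset.range t : Set ℕ) fun i => hopBall G (x i) 2 := by
    have haux : ∀ i j, i < j → j < t → Disjoint (hopBall G (x i) 2) (hopBall G (x j) 2) := by
      intro i j hij hj
      rw [Finset.disjoint_left]
      intro w hwi hwj
      rw [mem_hopBall] at hwi hwj
      have h1 := hx i (by omega)
      have h2 := hx j (by omega)
      have h3 := hG.dist_triangle (u := v) (v := x i) (w := w)
      have h4 := hG.dist_triangle (u := v) (v := w) (w := x j)
      rw [SimpleGraph.dist_comm (u := w)] at h4
      omega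
    intro i hi j hj hij
    have hi : i < t := by simpa using hi
    have hj : j < t := by simpa using hj
    rcases lt_or_gt_of_ne hij with h | h
    · exact haux i j h hj
    · exact (haux j i h hi).symm
  have hsub : (Finset.range t).biUnion (fun i => hopBall G (x i) 2) ⊆ hopBall G v r := by
    intro w hw
    obtain ⟨i, hi, hw⟩ := Finset.mem_biUnion.1 hw
    have hi : i < t := by simpa using hi
    rw [mem_hopBall] at hw ⊢
    have h1 := hx i hi
    have h2 := hG.dist_triangle (u := v) (v := x i) (w := w)
    omega
  have hcard := Finset.card_le_card hsub
  rw [Finset.card_biUnion hdisj] at hcard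
  calc t * b = ∑ _i ∈ Finset.range t, b := by simp
    _ ≤ ∑ i ∈ Finset.range t, ((hopBall G (x i) 2).card : ℝ) := Finset.sum_le_sum fun i _ => hb _
    _ ≤ _ := by exact_mod_cast hcard

theorem IsNash.dist_le {α : ℝ≥0} {S : Profile V} (hS : IsNash α S)
    (hV : 2 ≤ Fintype.card V) (u v : V) :
    ((net (edges S)).dist u v : ℝ) ≤ 20 + 80 * (α / Real.sqrt (Fintype.card V)) := by
  have hcon := connected_erase_of_expDist (hS.expDist_ne_top u)
  have hm := card_le_card_of_connected_erase hV hcon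
  have hG : (net (edges S)).Connected :=
    (hcon s(u, u)).mono (net_mono (Multiset.erase_le _ _))
  have hE : edges S ≠ 0 := by
    rw [← Multiset.card_pos]
    omega
  set G := net (edges S) with hGdef
  have hn : (2 : ℝ) ≤ Fintype.card V := by exact_mod_cast hV
  have hα : (0 : ℝ) ≤ α := α.2
  have hlt := dist_lt_card hG u v
  by_cases hD : G.dist u v < 20
  · have : (G.dist u v : ℝ) < 20 := by exact_mod_cast hD
    have : (0 : ℝ) ≤ α / Real.sqrt (Fintype.card V) := by positivity
    linarith
  obtain ⟨D, hDdef⟩ : ∃ D, D = G.dist u v := ⟨_, rfl⟩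
  rw [← hDdef] at hD hlt ⊢
  obtain ⟨r, hr⟩ : ∃ r, r = D / 4 := ⟨_, rfl⟩
  -- A node within r of v is at least D - r = r + 1 + γ away from u.
  obtain ⟨γ, hγ⟩ : ∃ γ, γ = D - 2 * r - 1 := ⟨_, rfl⟩
  obtain ⟨t, ht⟩ : ∃ t, t = (r + 3) / 5 := ⟨_, rfl⟩
  have huv : u ≠ v := by
    rintro rfl
    rw [SimpleGraph.dist_self] at hDdef
    omega
  have h1 := hS.mul_card_le hE huv (hopBall G v r) γ (by
    intro w hw
    rw [mem_hopBall] at hw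
    have := hG.dist_triangle (u := u) (v := w) (w := v)
    rw [SimpleGraph.dist_comm (u := w)] at this
    exact ⟨r, hw, by rw [← hGdef]; omega, by omega⟩)
  have hpos : (0 : ℝ) < 2 * (4 * α + 1) := by linarith
  have h2 := mul_le_card_hopBall hG (u := u) (v := v) (r := r) (t := t)
    (b := Fintype.card V / (2 * (4 * α + 1)))
    (fun x => (div_le_iff₀' hpos).2 (hS.card_le_mul_card_hopBall hV x))
    (by rw [SimpleGraph.dist_comm]; omega) (by omega)
  rw [← mul_div_assoc, div_le_iff₀ hpos] at h2
  have hγ4 : (D : ℝ) ≤ 4 * γ := by exact_mod_cast (show D ≤ 4 * γ by omega)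
  have ht40 : (D : ℝ) ≤ 40 * t := by exact_mod_cast (show D ≤ 40 * t by omega)
  have hball : (1 : ℝ) ≤ (hopBall G v r).card := by
    exact_mod_cast Finset.card_pos.2 ⟨v, mem_hopBall.2 (by simp)⟩
  have hD20 : (20 : ℝ) ≤ D := by exact_mod_cast not_lt.1 hD
  set B : ℝ := ((hopBall G v r).card : ℝ)
  set n : ℝ := (Fintype.card V : ℝ)
  -- Follows from γB ≤ 4α with γ ≥ 5 and B ≥ 1; it lets 4α + 1 ≤ 5α close the estimate with constant
  -- 80.
  have hα1 : (1 : ℝ) ≤ α := by nlinarith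
  have hsq : (D * Real.sqrt n) ^ 2 ≤ (80 * α) ^ 2 := by
    rw [mul_pow, Real.sq_sqrt (by linarith)]
    calc (D : ℝ) ^ 2 * n = D * D * n := by ring
      _ ≤ (4 * γ) * (40 * t) * n := by gcongr
      _ = 160 * γ * (t * n) := by ring
      _ ≤ 160 * γ * (B * (2 * (4 * α + 1))) := by gcongr
      _ = 320 * (4 * α + 1) * (γ * B) := by ring
      _ ≤ 320 * (4 * α + 1) * (4 * α) := by gcongr
      _ ≤ (80 * α) ^ 2 := by nlinarith
  have h3 := abs_le_of_sq_le_sq hsq (by linarith)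
  have hs : 0 < Real.sqrt n := Real.sqrt_pos.2 (by linarith)
  have h4 : (D : ℝ) ≤ 80 * (α / Real.sqrt n) := by
    rw [← mul_div_assoc, le_div_iff₀ hs]
    exact (le_abs_self _).trans h3
  linarith

/-- The social cost of an equilibrium in terms of a bound on its diameter: every agent could
instead buy only its part of a sparse robust subnetwork. -/
theorem IsNash.socialCost_le {α : ℝ≥0} {S : Profile V} (hS : IsNash α S) [Nonempty V] {D : ℕ}
    (hD : ∀ u v, (net (edges S)).dist u v ≤ D) :
    socialCost α S ≤ α * (2 * Fintype.card V : ℕ) +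
      Fintype.card V * (Fintype.card V * (6 * D + 2 : ℕ)) := by
  obtain ⟨v₀⟩ := ‹Nonempty V›
  obtain ⟨H, hH, hcard, hdist⟩ := exists_sparse_subnetwork (edges S)
    (connected_erase_of_expDist (hS.expDist_ne_top v₀)) v₀ D (hD v₀)
  obtain ⟨T, hTS, rfl⟩ := exists_profile_of_le_edges S hH
  -- The other agents keep all their edges, so the sparse network survives the deviation of u.
  have hle : ∀ u, edges T ≤ edges (Function.update S u (T u)) := by
    intro u
    conv_lhs => rw [← Function.update_eq_self u T]
    rw [edges_update, edges_update]
    exact add_le_add le_rfl (Finset.sum_le_sum fun w _ => Multiset.map_le_map (hTS w))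
  have hagent : ∀ u, agentCost α S u ≤
      α * Multiset.card (T u).1 + Fintype.card V * (6 * D + 2 : ℕ) := by
    intro u
    refine (not_lt.1 (hS u (T u))).trans ?_
    rw [agentCost, Function.update_self]
    refine add_le_add le_rfl (expDist_le fun e v => ?_)
    refine (hopDist_anti (Multiset.erase_le_erase e (hle u)) u v).trans ?_
    exact hopDist_le_iff.2 (hdist e u v)
  refine (Finset.sum_le_sum fun u _ => hagent u).trans ?_
  rw [Finset.sum_add_distrib, ← Finset.mul_sum, ← Nat.cast_sum, ← card_edges, Finset.sum_const,
    nsmul_eq_mul, Finset.card_univ]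
  gcongr

end Diameter

/-! ### The Price of Anarchy -/

theorem priceOfAnarchy_le (n : ℕ) (hn : 2 ≤ n) (α : ℝ≥0) :
    priceOfAnarchy n α ≤ ((1000 * (1 + α / NNReal.sqrt (n : ℝ≥0)) : ℝ≥0) : ℝ≥0∞) := by
  have hV : 2 ≤ Fintype.card (Fin n) := by simpa using hn
  have hopt : ((α * n + n * (n - 1 : ℕ) : ℝ≥0) : ℝ≥0∞) ≤ optCost n α := by
    refine le_iInf fun S => ?_
    have := le_socialCost hV α S
    rw [Fintype.card_fin] at this
    exact_mod_cast this
  refine ENNReal.div_le_of_le_mul (le_trans ?_ (mul_le_mul_right hopt _))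
  refine iSup₂_le fun S hS => ?_
  have : Nonempty (Fin n) := ⟨⟨0, by omega⟩⟩
  have hq : (0 : ℝ) ≤ α / Real.sqrt n := by positivity
  obtain ⟨D, hDdef⟩ : ∃ D, D = ⌊20 + 80 * ((α : ℝ) / Real.sqrt n)⌋₊ := ⟨_, rfl⟩
  have hcost := hS.socialCost_le (D := D) fun u v => by
    rw [hDdef]
    refine Nat.le_floor ?_
    have := hS.dist_le hV u v
    rwa [Fintype.card_fin] at this
  have hD : (D : ℝ) ≤ 20 + 80 * ((α : ℝ) / Real.sqrt n) := by
    rw [hDdef]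
    exact Nat.floor_le (by linarith)
  rw [Fintype.card_fin] at hcost
  refine hcost.trans ?_
  have hmain : α * (2 * n : ℕ) + n * (n * (6 * D + 2 : ℕ)) ≤
      1000 * (1 + α / NNReal.sqrt (n : ℝ≥0)) * (α * n + n * (n - 1 : ℕ)) := by
    rw [← NNReal.coe_le_coe]
    obtain ⟨k, rfl⟩ : ∃ k, n = k + 2 := ⟨n - 2, by omega⟩
    have hk : k + 2 - 1 = k + 1 := rfl
    rw [hk]
    simp only [NNReal.coe_add, NNReal.coe_mul, NNReal.coe_natCast, NNReal.coe_div,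
      Real.coe_sqrt, NNReal.coe_one, NNReal.coe_ofNat, Nat.cast_add, Nat.cast_mul,
      Nat.cast_ofNat, Nat.cast_one] at hD hq ⊢
    set q := (α : ℝ) / Real.sqrt (k + 2)
    have hα : (0 : ℝ) ≤ α := α.2
    have hk0 : (0 : ℝ) ≤ k := k.cast_nonneg
    -- Uses n ≤ 2(n-1) and 6D + 2 ≤ 122 + 480q; the resulting 960 is below 1000.
    have h1 : ((k : ℝ) + 2) * ((k + 2) * (6 * D + 2)) ≤
        (k + 2) * ((2 * (k + 1)) * (480 * (1 + q))) := by
      gcongr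
      · linarith
      · linarith
    have h2 : (0 : ℝ) ≤ q * (α * (k + 2)) := by positivity
    have h3 : (0 : ℝ) ≤ (1 + q) * ((k + 2) * (k + 1)) := by positivity
    have h4 : (0 : ℝ) ≤ α * (k + 2) := by positivity
    linarith
  exact_mod_cast hmain

end AdvNCG

theorem mainTheorem1 :
    (∃ C : ℝ≥0, ∀ n : ℕ, 2 ≤ n → ∀ α : ℝ≥0,
      AdvNCG.priceOfAnarchy n α ≤ ((C * (1 + α / NNReal.sqrt (n : ℝ≥0)) : ℝ≥0) : ℝ≥0∞)) ∧
    (∀ K : ℝ≥0, ∃ C : ℝ≥0, ∀ n : ℕ, 2 ≤ n → ∀ α : ℝ≥0,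
      α ≤ K * NNReal.sqrt (n : ℝ≥0) → AdvNCG.priceOfAnarchy n α ≤ (C : ℝ≥0∞)) := by
  refine ⟨⟨1000, AdvNCG.priceOfAnarchy_le⟩, fun K => ⟨1000 * (1 + K), fun n hn α hα => ?_⟩⟩
  refine (AdvNCG.priceOfAnarchy_le n hn α).trans ?_
  rw [ENNReal.coe_le_coe]
  gcongr
  exact div_le_of_le_mul₀ zero_le zero_le hα
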